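/- **Umbral notions.** An umbra $\alpha$ is a letter of an alphabet $\mathcal A$ representing a sequence of moments $a_n=E[\alpha^n]\in\mathbb R[x]$ with $a_0=1$ (infinitely many letters for each sequence), where $E:\mathbb R[x][\mathcal A]\to\mathbb R[x]$ is the $\mathbb R[x]$-linear functional with $E[\alpha^i\delta^j\cdots]=E[\alpha^i]E[\delta^j]\cdots$ for distinct letters. Write $\alpha\equiv\delta$ if $E[\alpha^n]=E[\delta^n]$ for all $n\ge0$, and $f(\alpha,z)=\sum_{n\ge0}E[\alpha^n]z^n/n!$ (a formal power series). $B_{i,k}$ are the exponential partial Bell polynomials, $\bigl(\sum_{r\ge1}a_rz^r/r!\bigr)^k/k!=\sum_{i}B_{i,k}(a_1,\dots,a_{i-k+1})z^i/i!$, and $(y)_k=y(y-1)\cdots(y-k+1)$. For $p$ a real number or an umbra, $p\cdot\alpha$ is the umbra with moments $E[(p\cdot\alpha)^i]=E\bigl[\sum_{k=0}^i(p)_kB_{i,k}(a_1,\dots,a_{i-k+1})\bigr]$; iterated dot-products are read $p\cdot(\alpha\cdot\delta)$. The Bell umbra $\beta$ has the Bell numbers as moments; the singleton umbra $\chi$ has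 $E[\chi]=1$ and $E[\chi^n]=0$ for $n>1$. If $E[\gamma]\neq0$, a compositional inverse $\gamma^{<-1>}$ of $\gamma$ is an umbra with $\gamma\cdot\beta\cdot\gamma^{<-1>}\equiv\gamma^{<-1>}\cdot\beta\cdot\gamma\equiv\chi$. A cumulant umbra of $\delta$ is an umbra $\kappa$ with $\delta\equiv\beta\cdot\kappa$. A family $P(x,t)\in\mathbb R[x]$, $t\ge0$, is time-space harmonic with respect to a family $q(t)=\theta(t)\cdot\delta$, $t\ge 0$ (with $\theta(t)\in\mathbb R$), if $E[P(q(t),t)\mid q(s)]=P(q(s),s)$ for all $0\le s\le t$, as polynomials in $q(s)$, where $E[\,\cdot\mid q(s)]$ is the linear extension of $$E[q(t)^k\mid q(s)]=\sum_{j=0}^k\binom kj\,q(s)^j\,E\bigl[((\theta(t)-\theta(s))\cdot\delta)^{k-j}\bigr].$$ It is time-space harmonic with respect to a stochastic process $(X_t)_{t\ge0}$ if $P(X_t,t)$ is integrable for every $t\ge0$ and $E[P(X_t,t)\mid\sigma(X_r:r\le s)]=P(X_s,s)$ almost surely for all $0\le s\le t$. A real Lévy process is a process starting from $0$ with stationary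 and independent increments; it is umbrally represented by $\{q(t)\}_{t\ge0}$ if all its moments are finite and $E[X_t^n]=E[q(t)^n]$ for all $n\ge 0$, $t\ge0$. **Theorem.** Let $\{V_k(x,t)\}$ ($k\ge0$, $t\ge0$, $V_k(\cdot,t)\in\mathbb R[x]$) be a Lévy–Sheffer system: for every $t\ge0$ and $x\in\mathbb R$, for $z$ in a neighbourhood of $0$, $$\sum_{k\ge0}V_k(x,t)\frac{z^k}{k!}=g(z)^t\exp\{x\,u(z)\},$$ where $g,u$ are real functions analytic in a neighbourhood of $0$, $u(0)=0$, $g(0)=1$, $u'(0)\ne0$, and $1/g(\tau(z))$, with $\tau(u(z))=z$ near $0$, is near $0$ the moment generating function of an infinitely divisible law. Let $\alpha,\gamma$ be umbrae with $f(\alpha,z)=g(z)$ and $f(\gamma,z)=1+u(z)$ (as Taylor series), and $g_j=E[\gamma^j]$. Then $\gamma$ has a compositional inverse $\gamma^{<-1>}$ and, for every such $\gamma^{<-1>}$, the umbra $\alpha\cdot\beta\cdot\gamma^{<-1>}$ has a cumulant umbra; and: 1. for every cumulant umbra $\kappa$ of $\alpha\cdot\beta\cdot\gamma^{<-1>}$,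 every $k\ge0$ and every $t\ge0$, $$V_k(x,t)=\sum_{i=0}^kE[(x+t\cdot\beta\cdot\kappa)^i]\,B_{k,i}(g_1,\dots,g_{k-i+1})\quad\text{in }\mathbb R[x];$$ 2. for every $k\ge0$, $V_k(x,t)$ is time-space harmonic with respect to $\{-t\cdot\alpha\cdot\beta\cdot\gamma^{<-1>}\}_{t\ge0}$; 3. for every $k\ge0$, $V_k(x,t)$ is time-space harmonic with respect to every real Lévy process umbrally represented by $\{-t\cdot\alpha\cdot\beta\cdot\gamma^{<-1>}\}_{t\ge0}$. -/

import Mathlib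

open MeasureTheory ProbabilityTheory Filter Topology
open scoped Polynomial NNReal

noncomputable section

/-- The exponential partial Bell polynomial `B_{n,k}(a 1, a 2, …, a (n-k+1))`, read off from
`(∑_{r ≥ 1} a_r z^r / r!)^k / k! = ∑_n B_{n,k} z^n / n!`.  The value `a 0` is not used. -/
def partialBell (n k : ℕ) (a : ℕ → ℝ[X]) : ℝ[X] :=
  Polynomial.C ((n.factorial : ℝ) / (k.factorial : ℝ)) *
    PowerSeries.coeff n
      ((PowerSeries.mk fun r : ℕ =>
        if r = 0 then (0 : ℝ[X]) else Polynomial.C ((r.factorial : ℝ)⁻¹) * a r) ^ k)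

/-- The letters of the (saturated) umbral alphabet: every unital sequence in `ℝ[x]` is represented
by infinitely many distinct letters, told apart by `label`. -/
structure Umbra where
  moment : ℕ → ℝ[X]
  moment_zero : moment 0 = 1
  label : ℕ

/-- Umbral polynomials, the elements of `ℝ[x][𝒜]`. -/
abbrev UmbralPoly : Type := MvPolynomial Umbra ℝ[X]

/-- The evaluation `E : ℝ[x][𝒜] → ℝ[x]`: the `ℝ[x]`-linear functional with
`E[α^i β^j ⋯ γ^k] = E[α^i] E[β^j] ⋯ E[γ^k]` for distinct letters. -/
def umbralE : UmbralPoly →ₗ[ℝ[X]] ℝ[X] :=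
  (MvPolynomial.basisMonomials Umbra ℝ[X]).constr ℝ[X]
    fun m : Umbra →₀ ℕ => m.prod fun α n => α.moment n

namespace Umbra

/-- The umbra as an element of `ℝ[x][𝒜]`. -/
def toPoly (α : Umbra) : UmbralPoly := MvPolynomial.X α

/-- Similarity `α ≡ γ`. -/
def Similar (α γ : Umbra) : Prop := ∀ n : ℕ, umbralE (α.toPoly ^ n) = umbralE (γ.toPoly ^ n)

/-- The generating function `f(α, z) = ∑ E[α^n] z^n / n!`, a formal power series over `ℝ[x]`. -/
def genFun (α : Umbra) : PowerSeries ℝ[X] :=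
  PowerSeries.mk fun n : ℕ => Polynomial.C ((n.factorial : ℝ)⁻¹) * umbralE (α.toPoly ^ n)

/-- The Bell umbra `β`. -/
def bell : Umbra where
  moment n := (n.bell : ℝ[X])
  moment_zero := by simp
  label := 0

/-- The singleton umbra `χ`. -/
def singleton : Umbra where
  moment n := if n ≤ 1 then 1 else 0
  moment_zero := by simp
  label := 0

/-- `q_i(p) = ∑_{k ≤ i} (p)_k B_{i,k}(a_1, …, a_{i-k+1})`, where `a_n` are the moments of `α` and
`(p)_k` is the lower factorial of the umbral polynomial `p`. -/
def dotPoly (p : UmbralPoly) (α : Umbra) (i : ℕ) : UmbralPoly :=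
  ∑ k ∈ Finset.range (i + 1),
    Polynomial.aeval p (descPochhammer ℝ k) * MvPolynomial.C (partialBell i k α.moment)

theorem umbralE_one : umbralE 1 = 1 := by
  have h : (1 : UmbralPoly) = MvPolynomial.basisMonomials Umbra ℝ[X] 0 := by
    simp [MvPolynomial.coe_basisMonomials]
  rw [h, umbralE, Module.Basis.constr_basis]
  simp

/-- The auxiliary umbra `p · α`, whose moments are `E[(p · α)^i] = E[q_i(p)]`. -/
def dotAux (p : UmbralPoly) (α : Umbra) : Umbra where
  moment i := umbralE (dotPoly p α i)
  moment_zero := by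
    have h : dotPoly p α 0 = 1 := by simp [dotPoly, partialBell]
    rw [h, umbralE_one]
  label := 0

/-- The dot-product `γ · α` of two umbrae. -/
def dot (γ α : Umbra) : Umbra := dotAux γ.toPoly α

/-- The dot-product `t · α` of a real number and an umbra. -/
def realDot (t : ℝ) (α : Umbra) : Umbra := dotAux (MvPolynomial.C (Polynomial.C t)) α

/-- The composition umbra `α · β · γ`, with `β` the Bell umbra. -/
def comp (α γ : Umbra) : Umbra := dot α (dot bell γ)

/-- `η` is a compositional inverse `α^{<-1>}` of `α`. -/
def IsCompInverse (α η : Umbra) : Prop :=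
  umbralE α.toPoly ≠ 0 ∧ Similar (comp α η) singleton ∧ Similar (comp η α) singleton

/-- `κ` is an `α`-cumulant umbra: `α ≡ β · κ`. -/
def IsCumulant (κ α : Umbra) : Prop := Similar α (dot bell κ)

/-- The conditional evaluation given `s · α` of polynomials in `t · α`: the linear extension of
`E[(t·α)^k | s·α] = ∑_j (k choose j) (s·α)^j E[((t - s)·α)^(k - j)]`. -/
def condE (α : Umbra) (s t : ℝ) : ℝ[X] →ₗ[ℝ] UmbralPoly :=
  (Polynomial.basisMonomials ℝ).constr ℝ fun k : ℕ =>
    ∑ j ∈ Finset.range (k + 1), (k.choose j : UmbralPoly) * (realDot s α).toPoly ^ j *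
      MvPolynomial.C (umbralE ((realDot (t - s) α).toPoly ^ (k - j)))

/-- `P(x, t)`, `t ≥ 0`, is time-space harmonic with respect to the family of auxiliary umbrae
`q(t) = θ(t) · α`, `t ≥ 0`: `E[P(q(t), t) | q(s)] = P(q(s), s)` for `0 ≤ s ≤ t`, as polynomials in
the umbra `q(s)`. -/
def IsTimeSpaceHarmonic (P : ℝ → ℝ[X]) (θ : ℝ → ℝ) (α : Umbra) : Prop :=
  ∀ s t : ℝ, 0 ≤ s → s ≤ t →
    condE α (θ s) (θ t) (P t) = Polynomial.aeval (realDot (θ s) α).toPoly (P s)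

end Umbra

/-- The Taylor series at `0` of a real function, with coefficients regarded in `ℝ[x]`. -/
def taylorAtZero (h : ℝ → ℝ) : PowerSeries ℝ[X] :=
  PowerSeries.mk fun n : ℕ => Polynomial.C ((n.factorial : ℝ)⁻¹ * iteratedDeriv n h 0)

/-- Infinite divisibility of a law on `ℝ`: for every `n ≥ 1` it is the law of a sum of `n`
independent, identically distributed random variables. -/
def IsInfinitelyDivisible (μ : Measure ℝ) : Prop :=
  ∀ n : ℕ, 1 ≤ n → ∃ ν : Measure ℝ, IsProbabilityMeasure ν ∧
    (Measure.pi fun _ : Fin n => ν).map (fun x => ∑ i, x i) = μ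

/-- `V k t = V_k(x, t)`, `t ≥ 0`, is a Lévy–Sheffer system with generating function
`g(z)^t exp(x u(z))`. -/
structure IsLevyShefferSystem (V : ℕ → ℝ → ℝ[X]) (g u : ℝ → ℝ) : Prop where
  analyticAt_g : AnalyticAt ℝ g 0
  analyticAt_u : AnalyticAt ℝ u 0
  g_zero : g 0 = 1
  u_zero : u 0 = 0
  deriv_u_ne_zero : deriv u 0 ≠ 0
  infinitelyDivisible : ∃ τ : ℝ → ℝ, (∀ᶠ z in 𝓝 (0 : ℝ), τ (u z) = z) ∧
    ∃ μ : Measure ℝ, IsProbabilityMeasure μ ∧ IsInfinitelyDivisible μ ∧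
      ∀ᶠ z in 𝓝 (0 : ℝ), Integrable (fun x : ℝ => Real.exp (z * x)) μ ∧
        mgf id μ z = 1 / g (τ z)
  genFun : ∀ t : ℝ, 0 ≤ t → ∀ x : ℝ, ∀ᶠ z in 𝓝 (0 : ℝ),
    HasSum (fun k : ℕ => (V k t).eval x * (z ^ k / (k.factorial : ℝ)))
      (g z ^ t * Real.exp (x * u z))

/-- A real Lévy process: it starts from `0` and has stationary and independent increments. -/
structure IsLevyProcess {Ω : Type*} [MeasurableSpace Ω] (X : ℝ≥0 → Ω → ℝ) (P : Measure Ω) :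
    Prop where
  measurable : ∀ t, Measurable (X t)
  start : ∀ᵐ ω ∂P, X 0 ω = 0
  indep : HasIndepIncrements X P
  stationary : ∀ s t : ℝ≥0, IdentDistrib (fun ω => X (s + t) ω - X s ω) (X t) P P

/-- The process `X` is umbrally represented by the family `q(t)`: `E[X_t^n] = E[q(t)^n]`. -/
def IsUmbrallyRepresented {Ω : Type*} [MeasurableSpace Ω] (X : ℝ≥0 → Ω → ℝ) (P : Measure Ω)
    (q : ℝ≥0 → Umbra) : Prop :=
  ∀ (t : ℝ≥0) (n : ℕ), Integrable (fun ω => X t ω ^ n) P ∧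
    Polynomial.C (∫ ω, X t ω ^ n ∂P) = umbralE ((q t).toPoly ^ n)

/-- `P(x, t)` is time-space harmonic with respect to the process `X`:
`E[P(X_t, t) | ℱ_s] = P(X_s, s)` for `s ≤ t`, with `ℱ` the natural filtration of `X`. -/
def IsTimeSpaceHarmonicProcess {Ω : Type*} [MeasurableSpace Ω] (Q : ℝ → ℝ[X])
    (X : ℝ≥0 → Ω → ℝ) (P : Measure Ω) : Prop :=
  (∀ t : ℝ≥0, Integrable (fun ω => (Q t).eval (X t ω)) P) ∧
  ∀ s t : ℝ≥0, s ≤ t →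
    P[fun ω => (Q t).eval (X t ω) | ⨆ r : Set.Iic s, MeasurableSpace.comap (X r) inferInstance]
      =ᵐ[P] fun ω => (Q s).eval (X s ω)

end

/-! Everything reduces to real formal power series. Let `A` and `U` be the Taylor series of g and u.
Expanding g^t exp(xu) in x shows that the coefficient of x^i in V_k is s(t;k,i) = (k!/i!) [z^k] A^t
U^i, which is `shefferCoeff`. The composition umbra α·β·γ^{<-1>} has generating function `G` =
A∘U^{-1}, so G∘U = A, and t times that umbra has generating function G^t, for t of either sign.

One identity, `sum_shefferCoeff_smul_binomial`, then carries all three claims: replacing each y^i in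
Σ_i s(a;k,i) y^i by Σ_j C(i,j) m_{i-j} y^j, where the m_n/n! are the coefficients of G^b, gives Σ_j
s(a+b;k,j) y^j. This is A^a·(G^b∘U) = A^{a+b}. For a = 0 and b = t the coefficients s(0;k,i) are
Bell polynomials in the moments of γ, which is claim 1. For a = t and b = s-t the replacement is
conditioning on time s, which is harmonicity.

For a Lévy process, independence of X_t - X_s from the past
(`IsLevyProcess.indepFun_past_increment`) gives the same binomial rule for conditional moments. -/

noncomputable section

/-! ### Formal power series: substitution, real powers, exponentials, and the core identity. -/

section FormalSeries

open PowerSeries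

variable {R : Type*} [CommRing R]

theorem coeff_pow_eq_zero_of_lt {D : R⟦X⟧} (hD : constantCoeff D = 0) {k n : ℕ} (h : k < n) :
    coeff k (D ^ n) = 0 :=
  X_pow_dvd_iff.1 (pow_dvd_pow_of_dvd (X_dvd_iff.2 hD) n) k h

theorem coeff_mul_pow_eq_zero_of_lt (F : R⟦X⟧) {D : R⟦X⟧} (hD : constantCoeff D = 0) {k n : ℕ}
    (h : k < n) : coeff k (F * D ^ n) = 0 :=
  X_pow_dvd_iff.1 ((pow_dvd_pow_of_dvd (X_dvd_iff.2 hD) n).mul_left F) k h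

theorem coeff_subst_eq_sum {D : R⟦X⟧} (hD : constantCoeff D = 0) (H : R⟦X⟧) {k N : ℕ}
    (h : k ≤ N) : coeff k (H.subst D : R⟦X⟧) =
      ∑ n ∈ Finset.range (N + 1), coeff n H * coeff k (D ^ n) := by
  rw [coeff_subst' (HasSubst.of_constantCoeff_zero' hD)]
  rw [finsum_eq_sum_of_support_subset]
  · rfl
  · intro n hn
    by_contra hc
    apply hn
    have : k < n := by simp at hc; omega
    simp [coeff_pow_eq_zero_of_lt hD this]

theorem coeff_mul_subst_eq_sum (F : R⟦X⟧) {D : R⟦X⟧} (hD : constantCoeff D = 0) (H : R⟦X⟧)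
    {k N : ℕ} (h : k ≤ N) : coeff k (F * H.subst D) =
      ∑ n ∈ Finset.range (N + 1), coeff n H * coeff k (F * D ^ n) := by
  rw [coeff_mul]
  have : ∀ p ∈ Finset.HasAntidiagonal.antidiagonal k, coeff p.1 F * coeff p.2 (H.subst D : R⟦X⟧) =
      ∑ n ∈ Finset.range (N + 1), coeff n H * (coeff p.1 F * coeff p.2 (D ^ n)) := by
    intro p hp
    have hp' : p.2 ≤ N := by have := Finset.HasAntidiagonal.mem_antidiagonal.1 hp; omega
    rw [coeff_subst_eq_sum hD H hp', Finset.mul_sum]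
    exact Finset.sum_congr rfl fun n _ => by ring
  rw [Finset.sum_congr rfl this, Finset.sum_comm]
  simp_rw [← Finset.mul_sum, ← coeff_mul]

theorem constantCoeff_subst_of_zero {D : R⟦X⟧} (hD : constantCoeff D = 0) (H : R⟦X⟧) :
    constantCoeff (H.subst D : R⟦X⟧) = constantCoeff H := by
  have := coeff_subst_eq_sum hD H (le_refl 0)
  simpa using this

/-- The real power `F ^ t` of a formal power series `F` with constant coefficient `1`. -/
def binPow (F : ℝ⟦X⟧) (t : ℝ) : ℝ⟦X⟧ := (PowerSeries.binomialSeries ℝ t).subst (F - 1)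

theorem constantCoeff_sub_one {F : R⟦X⟧} (hF : constantCoeff F = 1) :
    constantCoeff (F - 1) = 0 := by simp [hF]

theorem hasSubst_sub_one {F : R⟦X⟧} (hF : constantCoeff F = 1) : HasSubst (F - 1) :=
  HasSubst.of_constantCoeff_zero' (constantCoeff_sub_one hF)

theorem subst_one {D : R⟦X⟧} (hD : HasSubst D) : (1 : R⟦X⟧).subst D = (1 : R⟦X⟧) := by
  rw [← coe_substAlgHom hD, map_one]

theorem constantCoeff_binPow {F : ℝ⟦X⟧} (hF : constantCoeff F = 1) (t : ℝ) :
    constantCoeff (binPow F t) = 1 := by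
  rw [binPow, constantCoeff_subst_of_zero (constantCoeff_sub_one hF), binomialSeries_constantCoeff]

theorem binPow_zero {F : ℝ⟦X⟧} (hF : constantCoeff F = 1) : binPow F 0 = 1 := by
  rw [binPow, binomialSeries_zero, subst_one (hasSubst_sub_one hF)]

theorem binPow_add {F : ℝ⟦X⟧} (hF : constantCoeff F = 1) (s t : ℝ) :
    binPow F (s + t) = binPow F s * binPow F t := by
  rw [binPow, binomialSeries_add, subst_mul (hasSubst_sub_one hF)]; rfl

theorem binPow_subst {F D : ℝ⟦X⟧} (hF : constantCoeff F = 1) (hD : constantCoeff D = 0) (t : ℝ) :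
    (binPow F t).subst D = binPow (F.subst D) t := by
  have hD' := HasSubst.of_constantCoeff_zero' hD
  rw [binPow, subst_comp_subst_apply (hasSubst_sub_one hF) hD', binPow, subst_sub hD',
    subst_one hD']

theorem choose_eq_descPochhammer_eval (t : ℝ) (n : ℕ) :
    Ring.choose t n = (n.factorial : ℝ)⁻¹ * (descPochhammer ℝ n).eval t := by
  rw [Ring.choose_eq_smul, smul_eq_mul, ← Polynomial.aeval_eq_smeval, ← descPochhammer_map
    (Int.castRingHom ℝ), Polynomial.eval_map, Polynomial.aeval_def]
  rfl

/-- The equation (1+z)y' = ty encodes the recurrence (n+1) C(t,n+1) = (t-n) C(t,n). Substituting F -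
1 for z turns it into the equation for F^t. -/
theorem derivative_binomialSeries (t : ℝ) :
    (1 + X) * d⁄dX ℝ (PowerSeries.binomialSeries ℝ t) = C t * PowerSeries.binomialSeries ℝ t := by
  have key : ∀ n : ℕ, Ring.choose t (n + 1) * (n + 1) = (t - n) * Ring.choose t n := by
    intro n
    have h := descPochhammer_succ_eval n t
    rw [choose_eq_descPochhammer_eval, choose_eq_descPochhammer_eval, h, Nat.factorial_succ]
    have := Nat.factorial_ne_zero n
    push_cast
    field_simp
  ext n
  rw [add_mul, one_mul, map_add, coeff_C_mul, coeff_derivative, binomialSeries_coeff,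
    binomialSeries_coeff]
  cases n with
  | zero => simp
  | succ n =>
    rw [coeff_succ_X_mul, coeff_derivative, binomialSeries_coeff]
    have := key (n + 1)
    push_cast at this ⊢
    simp only [smul_eq_mul, mul_one]
    linear_combination this

theorem derivative_binPow {F : ℝ⟦X⟧} (hF : constantCoeff F = 1) (t : ℝ) :
    F * d⁄dX ℝ (binPow F t) = C t * d⁄dX ℝ F * binPow F t := by
  have h := hasSubst_sub_one hF
  have h1 := congrArg (fun S : ℝ⟦X⟧ => (S.subst (F - 1) : ℝ⟦X⟧)) (derivative_binomialSeries t)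
  simp only [subst_mul h, subst_add h, subst_one h, subst_X h, subst_C] at h1
  have h2 : d⁄dX ℝ (F - 1) = d⁄dX ℝ F := by simp
  rw [binPow, derivative_subst h, h2]
  have h3 : (1 + (F - 1)) = F := by ring
  rw [h3] at h1
  change _ = C t * _ at h1
  linear_combination d⁄dX ℝ F * h1

/-- The formal power series `exp (x D)`. -/
def expMul (x : ℝ) (D : ℝ⟦X⟧) : ℝ⟦X⟧ := (rescale x (exp ℝ)).subst D

theorem derivative_expMul {D : ℝ⟦X⟧} (hD : constantCoeff D = 0) (x : ℝ) :
    d⁄dX ℝ (expMul x D) = C x * d⁄dX ℝ D * expMul x D := by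
  have h := HasSubst.of_constantCoeff_zero' hD
  have h1 : d⁄dX ℝ (rescale x (exp ℝ)) = C x * rescale x (exp ℝ) := by
    ext n
    rw [coeff_derivative, coeff_rescale, coeff_C_mul, coeff_rescale]
    have h2 := congrArg (coeff n) (derivative_exp ℝ)
    rw [coeff_derivative] at h2
    rw [← h2]
    ring
  rw [expMul, derivative_subst h, h1, subst_mul h, subst_C]
  change C x * _ * _ = _
  ring

theorem constantCoeff_expMul {D : ℝ⟦X⟧} (hD : constantCoeff D = 0) (x : ℝ) :
    constantCoeff (expMul x D) = 1 := by
  rw [expMul, constantCoeff_subst_of_zero hD, ← coeff_zero_eq_constantCoeff_apply, coeff_rescale]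
  simp

theorem coeff_mul_expMul (F : ℝ⟦X⟧) {D : ℝ⟦X⟧} (hD : constantCoeff D = 0) (x : ℝ) (k : ℕ) :
    coeff k (F * expMul x D) =
      ∑ n ∈ Finset.range (k + 1), x ^ n / n.factorial * coeff k (F * D ^ n) := by
  rw [expMul, coeff_mul_subst_eq_sum F hD _ le_rfl]
  refine Finset.sum_congr rfl fun n _ => ?_
  rw [coeff_rescale, coeff_exp]
  simp [div_eq_mul_inv]

/-- Two formal solutions of the linear equation `A F' = B F` with the same nonzero initial value
agree. -/
theorem eq_of_linear_ode {K : Type*} [Field K] [CharZero K] {A B F S : K⟦X⟧} (hA : A ≠ 0)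
    (hS0 : constantCoeff S ≠ 0) (h0 : constantCoeff F = constantCoeff S)
    (hF : A * d⁄dX K F = B * F) (hS : A * d⁄dX K S = B * S) : F = S := by
  have hSS : S * S⁻¹ = 1 := PowerSeries.mul_inv_cancel S hS0
  -- The Wronskian of F and S vanishes, hence (F/S)' = 0.
  have h1 : d⁄dX K F * S = F * d⁄dX K S :=
    mul_left_cancel₀ hA (by linear_combination S * hF - F * hS)
  have h2 : F * S⁻¹ = 1 := by
    refine derivative.ext ?_ ?_
    · rw [Derivation.leibniz, derivative_inv', derivative_one, smul_eq_mul, smul_eq_mul]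
      linear_combination S⁻¹ ^ 2 * h1 - S⁻¹ * d⁄dX K F * hSS
    · rw [map_mul, h0, ← map_mul, hSS]
  calc F = F * S⁻¹ * S := by rw [mul_assoc, mul_comm S⁻¹, hSS, mul_one]
    _ = S := by rw [h2, one_mul]

/-- The number `k! [z^k] (A ^ t D ^ i) / i!`. -/
def shefferCoeff (A D : ℝ⟦X⟧) (t : ℝ) (k i : ℕ) : ℝ :=
  k.factorial / i.factorial * coeff k (binPow A t * D ^ i)

/-- In the coefficient of y^j the factorials cancel to k!/j!. What remains is [z^k] A^a D^j Σ_n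
([w^n] G^b) D^n, and the inner sum is G^b∘D = A^b. The variable y ranges over an algebra so that it
can be the indeterminate, an umbra or a value of the process. -/
theorem sum_shefferCoeff_smul_binomial {M : Type*} [CommRing M] [Algebra ℝ M] {A D G : ℝ⟦X⟧}
    (hA : constantCoeff A = 1) (hD : constantCoeff D = 0) (hG : constantCoeff G = 1)
    (hGD : G.subst D = A) (a b : ℝ) (k : ℕ) (y : M) :
    ∑ i ∈ Finset.range (k + 1), shefferCoeff A D a k i •
      ∑ j ∈ Finset.range (i + 1),
        ((i.choose j : ℝ) * ((i - j).factorial * coeff (i - j) (binPow G b))) • y ^ j =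
    ∑ j ∈ Finset.range (k + 1), shefferCoeff A D (a + b) k j • y ^ j := by
  have hG' : (binPow G b).subst D = binPow A b := by rw [binPow_subst hG hD, hGD]
  have h1 : ∀ i ∈ Finset.range (k + 1), shefferCoeff A D a k i •
      ∑ j ∈ Finset.range (i + 1),
        ((i.choose j : ℝ) * ((i - j).factorial * coeff (i - j) (binPow G b))) • y ^ j =
      ∑ j ∈ Finset.range (k + 1), (shefferCoeff A D a k i *
        ((i.choose j : ℝ) * ((i - j).factorial * coeff (i - j) (binPow G b)))) • y ^ j := by
    intro i hi
    rw [Finset.smul_sum]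
    simp_rw [smul_smul]
    refine Finset.sum_subset (Finset.range_mono (by simpa using hi)) fun j _ hj => ?_
    rw [Nat.choose_eq_zero_of_lt (by simpa using hj)]
    simp
  rw [Finset.sum_congr rfl h1, Finset.sum_comm]
  refine Finset.sum_congr rfl fun j _ => ?_
  rw [← Finset.sum_smul]
  congr 1
  -- The added terms vanish because D^i has order at least i > k. With this longer range, i = j + n
  -- lets n run over all of 0, …, k; the terms i < j vanish through the binomial coefficient.
  have h2 : ∑ i ∈ Finset.range (k + 1), shefferCoeff A D a k i *
        ((i.choose j : ℝ) * ((i - j).factorial * coeff (i - j) (binPow G b))) =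
      ∑ i ∈ Finset.range (j + (k + 1)), shefferCoeff A D a k i *
        ((i.choose j : ℝ) * ((i - j).factorial * coeff (i - j) (binPow G b))) := by
    refine Finset.sum_subset (Finset.range_mono (by omega)) fun i _ hi => ?_
    rw [shefferCoeff, coeff_mul_pow_eq_zero_of_lt _ hD (by simpa using hi)]
    simp
  rw [h2, Finset.sum_range_add, Finset.sum_eq_zero, zero_add, shefferCoeff, binPow_add hA,
    ← hG', mul_assoc, mul_comm _ (D ^ j), ← mul_assoc, coeff_mul_subst_eq_sum _ hD _ le_rfl,
    Finset.mul_sum]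
  · refine Finset.sum_congr rfl fun n _ => ?_
    have h3 := Nat.add_choose_mul_factorial_mul_factorial n j
    have h4 : ((j + n).choose j : ℝ) * j.factorial * n.factorial = (j + n).factorial := by
      rw [add_comm n j] at h3
      exact_mod_cast (by rw [← h3]; ring)
    rw [shefferCoeff, Nat.add_sub_cancel_left, mul_assoc _ (D ^ j), ← pow_add]
    have := Nat.factorial_ne_zero (j + n)
    have := Nat.factorial_ne_zero j
    field_simp
    rw [← h4]
    ring
  · intro i hi
    rw [Nat.choose_eq_zero_of_lt (by simpa using hi)]
    simp

end FormalSeries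

/-! ### From analytic functions to Taylor series, and the coefficients of V_k. -/

section TaylorSeries

open PowerSeries

/-- The Taylor series at `0` of a real function. -/
def realTaylor (h : ℝ → ℝ) : ℝ⟦X⟧ :=
  PowerSeries.mk fun n : ℕ => (n.factorial : ℝ)⁻¹ * iteratedDeriv n h 0

theorem taylorAtZero_eq_map (h : ℝ → ℝ) :
    taylorAtZero h = PowerSeries.map Polynomial.C (realTaylor h) := by
  ext1 n
  simp [taylorAtZero, realTaylor]

theorem constantCoeff_realTaylor (h : ℝ → ℝ) : constantCoeff (realTaylor h) = h 0 := by
  simp [← coeff_zero_eq_constantCoeff_apply, realTaylor]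

theorem coeff_one_realTaylor (h : ℝ → ℝ) : coeff 1 (realTaylor h) = deriv h 0 := by
  simp [realTaylor]

theorem realTaylor_congr {f h : ℝ → ℝ} (hfh : f =ᶠ[𝓝 0] h) : realTaylor f = realTaylor h := by
  ext n
  simp [realTaylor, hfh.iteratedDeriv_eq n]

theorem realTaylor_mul {f h : ℝ → ℝ} (hf : AnalyticAt ℝ f 0) (hh : AnalyticAt ℝ h 0) :
    realTaylor (fun z => f z * h z) = realTaylor f * realTaylor h := by
  ext n
  rw [coeff_mul, Finset.Nat.sum_antidiagonal_eq_sum_range_succ_mk]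
  simp only [realTaylor, coeff_mk]
  rw [iteratedDeriv_fun_mul hf.contDiffAt hh.contDiffAt, Finset.mul_sum]
  refine Finset.sum_congr rfl fun i hi => ?_
  rw [Nat.cast_choose ℝ (by simpa [Nat.lt_succ_iff] using hi)]
  have := Nat.factorial_ne_zero n
  have := Nat.factorial_ne_zero i
  have := Nat.factorial_ne_zero (n - i)
  field_simp

theorem realTaylor_const_mul {f : ℝ → ℝ} (hf : AnalyticAt ℝ f 0) (c : ℝ) :
    realTaylor (fun z => c * f z) = C c * realTaylor f := by
  ext n
  rw [coeff_C_mul]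
  simp only [realTaylor, coeff_mk]
  rw [iteratedDeriv_const_mul c hf.contDiffAt]
  ring

theorem realTaylor_add {f h : ℝ → ℝ} (hf : AnalyticAt ℝ f 0) (hh : AnalyticAt ℝ h 0) :
    realTaylor (fun z => f z + h z) = realTaylor f + realTaylor h := by
  ext n
  simp only [realTaylor, coeff_mk, map_add]
  rw [iteratedDeriv_fun_add hf.contDiffAt hh.contDiffAt]
  ring

theorem realTaylor_deriv (f : ℝ → ℝ) : realTaylor (deriv f) = d⁄dX ℝ (realTaylor f) := by
  ext n
  rw [coeff_derivative]
  simp only [realTaylor, coeff_mk]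
  rw [← iteratedDeriv_succ', Nat.factorial_succ]
  have := Nat.factorial_ne_zero n
  push_cast
  field_simp

theorem hasFPowerSeriesAt_of_hasSum {f : ℝ → ℝ} {a : ℕ → ℝ}
    (h : ∀ᶠ z in 𝓝 (0 : ℝ), HasSum (fun k : ℕ => a k * (z ^ k / (k.factorial : ℝ))) (f z)) :
    HasFPowerSeriesAt f (FormalMultilinearSeries.ofScalars ℝ fun k => a k / k.factorial) 0 := by
  rw [hasFPowerSeriesAt_iff']
  filter_upwards [h] with z hz
  convert! hz using 2 with k
  rw [FormalMultilinearSeries.coeff_ofScalars]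
  simp only [sub_zero, smul_eq_mul]
  ring

theorem realTaylor_eq_of_hasSum {f : ℝ → ℝ} {a : ℕ → ℝ}
    (h : ∀ᶠ z in 𝓝 (0 : ℝ), HasSum (fun k : ℕ => a k * (z ^ k / (k.factorial : ℝ))) (f z)) :
    realTaylor f = PowerSeries.mk fun k => a k / k.factorial := by
  have h1 := hasFPowerSeriesAt_of_hasSum h
  have h2 := h1.eq_formalMultilinearSeries h1.analyticAt.hasFPowerSeriesAt
  ext k
  have h3 := congrArg (fun p => FormalMultilinearSeries.coeff p k) h2
  simp only [FormalMultilinearSeries.coeff_ofScalars] at h3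
  rw [realTaylor, coeff_mk, coeff_mk, h3]
  ring

/-- The Taylor series of `g ^ t exp (x u)` is the corresponding formal expression. -/
theorem realTaylor_rpow_mul_exp {g u : ℝ → ℝ} (hg : AnalyticAt ℝ g 0) (hu : AnalyticAt ℝ u 0)
    (hg0 : g 0 = 1) (hu0 : u 0 = 0) (t x : ℝ) :
    realTaylor (fun z => g z ^ t * Real.exp (x * u z)) =
      binPow (realTaylor g) t * expMul x (realTaylor u) := by
  set f : ℝ → ℝ := fun z => g z ^ t * Real.exp (x * u z) with hf
  have hA : constantCoeff (realTaylor g) = 1 := by rw [constantCoeff_realTaylor, hg0]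
  have hD : constantCoeff (realTaylor u) = 0 := by rw [constantCoeff_realTaylor, hu0]
  -- Near 0 the real power is exp(t log g), hence analytic.
  have hgpos : ∀ᶠ z in 𝓝 (0 : ℝ), 0 < g z :=
    hg.continuousAt.eventually (lt_mem_nhds (by rw [hg0]; exact one_pos))
  have hfa : AnalyticAt ℝ f 0 := by
    have h1 : AnalyticAt ℝ (fun z => Real.exp (Real.log (g z) * t) * Real.exp (x * u z)) 0 :=
      (((hg.log (by rw [hg0]; exact one_pos)).mul analyticAt_const).rexp).mul
        (analyticAt_const.mul hu).rexp
    refine h1.congr ?_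
    filter_upwards [hgpos] with z hz
    rw [hf]
    simp only
    rw [Real.rpow_def_of_pos hz]
  -- Logarithmic derivative of f, cleared of its denominator g. The formal product satisfies the
  -- same linear equation with the same value at 0, so the two series coincide without expanding a
  -- real power.
  have hode : (fun z => g z * deriv f z) =ᶠ[𝓝 0]
      fun z => (t * deriv g z + x * (g z * deriv u z)) * f z := by
    filter_upwards [hgpos, hg.eventually_analyticAt, hu.eventually_analyticAt] with z hz hgz huz
    have h1 := (hgz.differentiableAt.hasDerivAt.rpow_const (p := t) (Or.inl hz.ne')).mul
      ((huz.differentiableAt.hasDerivAt.const_mul x).exp)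
    have h2 : deriv f z = _ := h1.deriv
    rw [h2, hf]
    simp only
    rw [Real.rpow_sub_one hz.ne']
    field_simp
  have hT := realTaylor_congr hode
  have h1 : AnalyticAt ℝ (fun z => g z * deriv u z) 0 := hg.mul hu.deriv
  have h2 : AnalyticAt ℝ (fun z => t * deriv g z) 0 := analyticAt_const.mul hg.deriv
  have h3 : AnalyticAt ℝ (fun z => x * (g z * deriv u z)) 0 := analyticAt_const.mul h1
  have h4 : AnalyticAt ℝ (fun z => t * deriv g z + x * (g z * deriv u z)) 0 := h2.add h3
  rw [realTaylor_mul hg hfa.deriv, realTaylor_mul h4 hfa, realTaylor_add h2 h3,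
    realTaylor_const_mul hg.deriv, realTaylor_const_mul h1, realTaylor_mul hg hu.deriv,
    realTaylor_deriv, realTaylor_deriv, realTaylor_deriv] at hT
  have hS0 : constantCoeff (binPow (realTaylor g) t * expMul x (realTaylor u)) = 1 := by
    rw [map_mul, constantCoeff_binPow hA, constantCoeff_expMul hD, one_mul]
  refine eq_of_linear_ode (A := realTaylor g) ?_ (by rw [hS0]; exact one_ne_zero) ?_ hT ?_
  · intro h
    rw [h] at hA
    simp at hA
  · rw [hS0, constantCoeff_realTaylor, hf]
    simp [hg0, hu0]
  · rw [Derivation.leibniz, smul_eq_mul, smul_eq_mul, derivative_expMul hD]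
    linear_combination expMul x (realTaylor u) * derivative_binPow hA t

theorem IsLevyShefferSystem.eq_sum_shefferCoeff {V : ℕ → ℝ → ℝ[X]} {g u : ℝ → ℝ}
    (hV : IsLevyShefferSystem V g u) {t : ℝ} (ht : 0 ≤ t) (k : ℕ) :
    V k t = ∑ i ∈ Finset.range (k + 1),
      shefferCoeff (realTaylor g) (realTaylor u) t k i • (Polynomial.X : ℝ[X]) ^ i := by
  refine Polynomial.funext fun x => ?_
  have h1 := realTaylor_eq_of_hasSum (hV.genFun t ht x)
  rw [realTaylor_rpow_mul_exp hV.analyticAt_g hV.analyticAt_u hV.g_zero hV.u_zero] at h1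
  have h2 := congrArg (coeff k) h1
  rw [coeff_mk, coeff_mul_expMul _ (by rw [constantCoeff_realTaylor, hV.u_zero]),
    eq_div_iff (by exact_mod_cast k.factorial_ne_zero), Finset.sum_mul] at h2
  rw [← h2, Polynomial.eval_finsetSum]
  refine Finset.sum_congr rfl fun i _ => ?_
  simp only [shefferCoeff, Polynomial.eval_smul, Polynomial.eval_pow, Polynomial.eval_X,
    smul_eq_mul]
  ring

end TaylorSeries

/-! ### Umbral operations as operations on generating functions. -/

namespace Umbra

open PowerSeries

theorem umbralE_toPoly_pow (α : Umbra) (n : ℕ) : umbralE (α.toPoly ^ n) = α.moment n := by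
  have h : α.toPoly ^ n = MvPolynomial.basisMonomials Umbra ℝ[X] (Finsupp.single α n) := by
    rw [MvPolynomial.coe_basisMonomials, toPoly, MvPolynomial.X_pow_eq_monomial]
  rw [h, umbralE, Module.Basis.constr_basis, Finsupp.prod_single_index α.moment_zero]

theorem umbralE_C_mul (q : ℝ[X]) (p : UmbralPoly) :
    umbralE (MvPolynomial.C q * p) = q * umbralE p := by
  rw [MvPolynomial.C_mul', map_smul, smul_eq_mul]

theorem umbralE_mul_C (p : UmbralPoly) (q : ℝ[X]) :
    umbralE (p * MvPolynomial.C q) = umbralE p * q := by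
  rw [mul_comm, umbralE_C_mul, mul_comm]

theorem umbralE_C (q : ℝ[X]) : umbralE (MvPolynomial.C q) = q := by
  simpa [umbralE_one] using umbralE_C_mul q 1

theorem coeff_genFun (α : Umbra) (n : ℕ) :
    coeff n α.genFun = Polynomial.C ((n.factorial : ℝ)⁻¹) * α.moment n := by
  rw [genFun, coeff_mk, umbralE_toPoly_pow]

theorem C_factorial_mul_C_inv (n : ℕ) :
    Polynomial.C (n.factorial : ℝ) * Polynomial.C (n.factorial : ℝ)⁻¹ = 1 := by
  rw [← map_mul, mul_inv_cancel₀ (by exact_mod_cast n.factorial_ne_zero), map_one]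

theorem moment_eq (α : Umbra) (n : ℕ) :
    α.moment n = Polynomial.C (n.factorial : ℝ) * coeff n α.genFun := by
  rw [coeff_genFun, ← mul_assoc, C_factorial_mul_C_inv, one_mul]

theorem constantCoeff_genFun (α : Umbra) : constantCoeff α.genFun = 1 := by
  rw [← coeff_zero_eq_constantCoeff_apply, coeff_genFun, α.moment_zero]
  simp

theorem similar_iff_genFun_eq {α γ : Umbra} : Similar α γ ↔ α.genFun = γ.genFun := by
  constructor
  · intro h
    ext1 n
    rw [genFun, genFun, coeff_mk, coeff_mk, h n]
  · intro h n
    rw [umbralE_toPoly_pow, umbralE_toPoly_pow, moment_eq, moment_eq, h]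

/-- An umbra with a prescribed generating function. -/
def ofGenFun (S : ℝ[X]⟦X⟧) (hS : constantCoeff S = 1) : Umbra where
  moment n := Polynomial.C (n.factorial : ℝ) * coeff n S
  moment_zero := by simp [hS]
  label := 0

theorem genFun_ofGenFun (S : ℝ[X]⟦X⟧) (hS : constantCoeff S = 1) :
    (ofGenFun S hS).genFun = S := by
  ext1 n
  rw [coeff_genFun, ofGenFun, ← mul_assoc, mul_comm (Polynomial.C _), C_factorial_mul_C_inv,
    one_mul]

theorem genFun_singleton : singleton.genFun = 1 + X := by
  ext1 n
  rw [coeff_genFun, singleton, map_add, coeff_one, coeff_X]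
  rcases n with _ | _ | n <;> simp

/-- The linear functional `p ↦ E[p(α)]` on real polynomials. -/
def evalAt (α : Umbra) : ℝ[X] →ₗ[ℝ] ℝ[X] :=
  umbralE.restrictScalars ℝ ∘ₗ (Polynomial.aeval α.toPoly).toLinearMap

theorem evalAt_apply (α : Umbra) (p : ℝ[X]) :
    evalAt α p = umbralE (Polynomial.aeval α.toPoly p) := rfl

theorem evalAt_X_pow (α : Umbra) (n : ℕ) : evalAt α (Polynomial.X ^ n) = α.moment n := by
  rw [evalAt_apply, map_pow, Polynomial.aeval_X, umbralE_toPoly_pow]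

/-- On monomials this is the Bell number recurrence B_{n+1} = Σ_i C(n,i) B_i. -/
theorem evalAt_bell_X_mul (p : ℝ[X]) :
    evalAt bell (Polynomial.X * p) = evalAt bell (p.comp (Polynomial.X + 1)) := by
  induction p using Polynomial.induction_on' with
  | add p q hp hq => rw [mul_add, map_add, hp, hq, Polynomial.add_comp, map_add]
  | monomial n a =>
    rw [← Polynomial.smul_X_eq_monomial, mul_smul_comm, map_smul, Polynomial.smul_comp, map_smul,
      ← pow_succ', evalAt_X_pow, Polynomial.X_pow_comp, add_comm Polynomial.X, add_pow, map_sum]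
    congr 1
    change (((n + 1).bell : ℕ) : ℝ[X]) = _
    rw [Nat.bell_succ, ← Nat.range_succ_eq_Iic, Nat.cast_sum]
    refine Finset.sum_congr rfl fun i _ => ?_
    rw [one_pow, one_mul, mul_comm (Polynomial.X ^ _), ← nsmul_eq_mul, map_nsmul, evalAt_X_pow,
      nsmul_eq_mul, Nat.cast_mul]
    rfl

/-- Since (y)_{k+1} = y (y-1)_k, the shift rule for β reduces the order by one. -/
theorem evalAt_bell_descPochhammer (k : ℕ) : evalAt bell (descPochhammer ℝ k) = 1 := by
  induction k with
  | zero =>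
    rw [descPochhammer_zero, evalAt_apply, map_one, umbralE_one]
  | succ k ih =>
    rw [descPochhammer_succ_left, evalAt_bell_X_mul, Polynomial.comp_assoc]
    simpa using ih

/-- The generating function `∑ E[(p)_k] z ^ k / k!` of the factorial moments of `p`. -/
def factorialGenFun (p : UmbralPoly) : ℝ[X]⟦X⟧ :=
  PowerSeries.mk fun k : ℕ => Polynomial.C ((k.factorial : ℝ)⁻¹) *
    umbralE (Polynomial.aeval p (descPochhammer ℝ k))

theorem factorialGenFun_bell : factorialGenFun bell.toPoly = exp ℝ[X] := by
  ext1 k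
  rw [factorialGenFun, coeff_mk, ← evalAt_apply, evalAt_bell_descPochhammer, coeff_exp]
  simp

theorem factorialGenFun_C (t : ℝ) : factorialGenFun (MvPolynomial.C (Polynomial.C t)) =
    PowerSeries.map Polynomial.C (PowerSeries.binomialSeries ℝ t) := by
  ext1 k
  have h : (MvPolynomial.C (Polynomial.C t) : UmbralPoly) = algebraMap ℝ UmbralPoly t := rfl
  have h2 (r : ℝ) : algebraMap ℝ UmbralPoly r = (MvPolynomial.C (Polynomial.C r)) := rfl
  rw [factorialGenFun, coeff_mk, h, Polynomial.aeval_algebraMap_apply, h2, umbralE_C,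
    coeff_map, binomialSeries_coeff, choose_eq_descPochhammer_eval, ← map_mul]
  simp

/-- Expansion of a power in falling factorials, with Stirling numbers read off from (e^z - 1)^k. At
a natural number N it is the coefficient of z^n in (1 + (e^z - 1))^N = e^{Nz}, and infinitely many
values determine a polynomial. -/
theorem sum_coeff_exp_sub_one_smul_descPochhammer (n : ℕ) :
    ∑ k ∈ Finset.range (n + 1), ((k.factorial : ℝ)⁻¹ * coeff n ((exp ℝ - 1) ^ k)) •
      descPochhammer ℝ k = ((n.factorial : ℝ)⁻¹) • Polynomial.X ^ n := by
  refine Polynomial.eq_of_infinite_eval_eq _ _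
    ((Set.infinite_range_of_injective (Nat.cast_injective (R := ℝ))).mono ?_)
  rintro _ ⟨N, rfl⟩
  have hE : HasSubst (exp ℝ - 1) := HasSubst.exp_sub_one
  have h1 : (PowerSeries.binomialSeries ℝ (N : ℝ)).subst (exp ℝ - 1) = exp ℝ ^ N := by
    rw [binomialSeries_nat, subst_pow hE, subst_add hE, subst_one hE, subst_X hE]
    congr 1
    ring
  have h2 := congrArg (coeff n) h1
  rw [coeff_subst_eq_sum (by simp) _ le_rfl, exp_pow_eq_rescale_exp, coeff_rescale, coeff_exp] at h2
  simp only [Set.mem_ofPred_eq, Polynomial.eval_finsetSum, Polynomial.eval_smul, Polynomial.eval_pow,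
    Polynomial.eval_X, smul_eq_mul]
  simp only [binomialSeries_coeff, choose_eq_descPochhammer_eval, smul_eq_mul, mul_one] at h2
  calc _ = _ := Finset.sum_congr rfl fun k _ => by ring
    _ = _ := h2
    _ = _ := by simp [mul_comm]

theorem map_C_exp : PowerSeries.map Polynomial.C (exp ℝ) = exp ℝ[X] := map_exp _

theorem factorialGenFun_subst_exp_sub_one (α : Umbra) :
    (factorialGenFun α.toPoly).subst (exp ℝ[X] - 1) = α.genFun := by
  ext1 n
  rw [coeff_subst_eq_sum (by simp) _ le_rfl, coeff_genFun, ← evalAt_X_pow,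
    ← Polynomial.smul_eq_C_mul, ← map_smul, ← sum_coeff_exp_sub_one_smul_descPochhammer, map_sum]
  refine Finset.sum_congr rfl fun k _ => ?_
  rw [factorialGenFun, coeff_mk, map_smul, evalAt_apply, Polynomial.smul_eq_C_mul, map_mul,
    ← coeff_map, map_pow (PowerSeries.map _), map_sub (PowerSeries.map _), map_one, map_C_exp]
  ring

theorem partialBell_eq (n k : ℕ) (α : Umbra) : partialBell n k α.moment =
    Polynomial.C ((n.factorial : ℝ) / k.factorial) * coeff n ((α.genFun - 1) ^ k) := by
  rw [partialBell]
  congr 4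
  ext1 r
  rw [coeff_mk, map_sub, coeff_genFun, coeff_one]
  split_ifs with h
  · subst h
    simp [α.moment_zero]
  · simp

theorem constantCoeff_genFun_sub_one (α : Umbra) : constantCoeff (α.genFun - 1) = 0 :=
  constantCoeff_sub_one α.constantCoeff_genFun

theorem hasSubst_genFun_sub_one (α : Umbra) : HasSubst (α.genFun - 1) :=
  hasSubst_sub_one α.constantCoeff_genFun

theorem genFun_dotAux (p : UmbralPoly) (α : Umbra) :
    (dotAux p α).genFun = (factorialGenFun p).subst (α.genFun - 1) := by
  ext1 n
  rw [coeff_subst_eq_sum α.constantCoeff_genFun_sub_one _ le_rfl, coeff_genFun]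
  change _ * umbralE (dotPoly p α n) = _
  rw [dotPoly, map_sum, Finset.mul_sum]
  refine Finset.sum_congr rfl fun k _ => ?_
  rw [umbralE_mul_C, partialBell_eq, factorialGenFun, coeff_mk, div_eq_mul_inv, map_mul]
  linear_combination umbralE ((Polynomial.aeval p) (descPochhammer ℝ k)) *
    Polynomial.C (k.factorial : ℝ)⁻¹ * coeff n ((α.genFun - 1) ^ k) * C_factorial_mul_C_inv n

theorem genFun_dot_bell (κ : Umbra) :
    (dot bell κ).genFun = (exp ℝ[X]).subst (κ.genFun - 1) := by
  rw [dot, genFun_dotAux, factorialGenFun_bell]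

theorem genFun_dot_bell_sub_one (κ : Umbra) :
    (dot bell κ).genFun - 1 = (exp ℝ[X] - 1).subst (κ.genFun - 1) := by
  rw [genFun_dot_bell, subst_sub κ.hasSubst_genFun_sub_one, subst_one κ.hasSubst_genFun_sub_one]

/-- The inner dot with β supplies e^w - 1 at w = f(η) - 1, which is exactly the substitution
converting the factorial moments of α into its moments. -/
theorem genFun_comp (α η : Umbra) : (comp α η).genFun = α.genFun.subst (η.genFun - 1) := by
  rw [comp, dot, genFun_dotAux, genFun_dot_bell_sub_one,
    ← subst_comp_subst_apply HasSubst.exp_sub_one η.hasSubst_genFun_sub_one,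
    factorialGenFun_subst_exp_sub_one]

theorem map_C_subst (F : ℝ⟦X⟧) {D : ℝ⟦X⟧} (hD : constantCoeff D = 0) :
    PowerSeries.map Polynomial.C (F.subst D : ℝ⟦X⟧) =
      (PowerSeries.map Polynomial.C F).subst (PowerSeries.map Polynomial.C D) :=
  map_subst (HasSubst.of_constantCoeff_zero' hD) F

theorem genFun_realDot {δ : Umbra} {G : ℝ⟦X⟧} (hG : constantCoeff G = 1)
    (hδ : δ.genFun = PowerSeries.map Polynomial.C G) (t : ℝ) :
    (realDot t δ).genFun = PowerSeries.map Polynomial.C (binPow G t) := by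
  rw [realDot, genFun_dotAux, factorialGenFun_C, binPow, map_C_subst _ (constantCoeff_sub_one hG),
    hδ, map_sub, map_one]

theorem moment_realDot {δ : Umbra} {G : ℝ⟦X⟧} (hG : constantCoeff G = 1)
    (hδ : δ.genFun = PowerSeries.map Polynomial.C G) (t : ℝ) (n : ℕ) :
    (realDot t δ).moment n = Polynomial.C (n.factorial * coeff n (binPow G t)) := by
  rw [moment_eq, genFun_realDot hG hδ, coeff_map, map_mul]

/-- Every umbra has a cumulant umbra. -/
theorem exists_isCumulant (δ : Umbra) : ∃ κ : Umbra, IsCumulant κ δ := by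
  have h1 : IsUnit (coeff 1 (exp ℝ[X] - 1)) := by simp [coeff_one]
  have h0 : constantCoeff (exp ℝ[X] - 1) = 0 := by simp
  -- `L` is log(1+z), obtained as the compositional inverse of e^z - 1; the cumulant umbra has
  -- generating function 1 + log f(δ).
  set L := (exp ℝ[X] - 1).substInvOfIsUnit h1
  have hL : constantCoeff L = 0 := constantCoeff_substInvOfIsUnit _ h1
  have hδ := δ.hasSubst_genFun_sub_one
  have hc : constantCoeff (1 + L.subst (δ.genFun - 1) : ℝ[X]⟦X⟧) = 1 := by
    rw [map_add, constantCoeff_subst_of_zero δ.constantCoeff_genFun_sub_one, hL]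
    simp
  refine ⟨ofGenFun _ hc, similar_iff_genFun_eq.2 ?_⟩
  rw [← sub_left_inj (a := 1), genFun_dot_bell_sub_one, genFun_ofGenFun, add_sub_cancel_left,
    ← subst_comp_subst_apply (HasSubst.of_constantCoeff_zero' hL) hδ,
    subst_substInvOfIsUnit_right _ h0, subst_X hδ]

end Umbra

/-! ### Conditional moments of a Lévy process. -/

section LevyProcess

/-- Along such a sequence every X_r with r in `J` is a sum of some of the first N increments, while
X_t - X_s is the increment of index N. Sorting J ∪ {0, s} and continuing with t produces it. -/
theorem exists_monotone_seq_through (J : Finset ℝ≥0) {s t : ℝ≥0} (hst : s ≤ t)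
    (hJ : ∀ r ∈ J, r ≤ s) : ∃ (τ : ℕ → ℝ≥0) (N : ℕ), Monotone τ ∧ τ 0 = 0 ∧ τ N = s ∧
      τ (N + 1) = t ∧ ∀ r ∈ J, ∃ i ≤ N, τ i = r := by
  classical
  set K : Finset ℝ≥0 := insert 0 (insert s J) with hK
  obtain ⟨N, hN⟩ : ∃ N, K.card = N + 1 :=
    Nat.exists_eq_succ_of_ne_zero (Finset.card_ne_zero_of_mem (Finset.mem_insert_self 0 _))
  have hKs : ∀ r ∈ K, r ≤ s := by
    intro r hr
    rcases Finset.mem_insert.1 hr with rfl | hr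
    · exact zero_le
    · rcases Finset.mem_insert.1 hr with rfl | hr
      · exact le_rfl
      · exact hJ r hr
  set e := K.orderEmbOfFin hN
  have he : ∀ r ∈ K, ∃ i : Fin (N + 1), e i = r := fun r hr => by
    have : r ∈ Set.range e := by rw [Finset.range_orderEmbOfFin]; exact hr
    exact this
  have hes : ∀ i, e i ≤ s := fun i => hKs _ (Finset.orderEmbOfFin_mem K hN i)
  refine ⟨fun i => if h : i < N + 1 then e ⟨i, h⟩ else t, N, ?_, ?_, ?_, ?_, ?_⟩
  · intro i j hij
    by_cases hj : j < N + 1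
    · have hi : i < N + 1 := hij.trans_lt hj
      simp only [hi, hj, dif_pos]
      exact e.monotone hij
    · by_cases hi : i < N + 1
      · simp only [hi, hj, dif_pos, dif_neg, not_false_eq_true]
        exact (hes _).trans hst
      · simp only [hi, hj, dif_neg, not_false_eq_true, le_refl]
  · obtain ⟨i, hi⟩ := he 0 (Finset.mem_insert_self _ _)
    simp only [Nat.succ_pos, dif_pos]
    exact le_antisymm ((e.monotone (Fin.zero_le i)).trans hi.le) zero_le
  · obtain ⟨i, hi⟩ := he s (Finset.mem_insert_of_mem (Finset.mem_insert_self _ _))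
    simp only [Nat.lt_succ_self, dif_pos]
    exact le_antisymm (hes _) (hi.symm.le.trans (e.monotone (Fin.le_last i)))
  · simp
  · intro r hr
    obtain ⟨i, hi⟩ := he r (Finset.mem_insert_of_mem (Finset.mem_insert_of_mem hr))
    exact ⟨i, Nat.lt_succ_iff.1 i.2, by simp only [i.2, dif_pos, Fin.eta, hi]⟩

variable {Ω : Type*} [MeasurableSpace Ω] {P : Measure Ω}
  {X : ℝ≥0 → Ω → ℝ}

/-- Independence from the whole past needs checking only on finitely many past times, where the
independence of successive increments applies. -/
theorem IsLevyProcess.indepFun_past_increment [IsProbabilityMeasure P] (hX : IsLevyProcess X P) {s t : ℝ≥0} (hst : s ≤ t) :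
    IndepFun (fun ω (r : Set.Iic s) => X r ω) (fun ω => X t ω - X s ω) P := by
  classical
  refine IndepFun.process_indepFun (fun r => hX.measurable r)
    ((hX.measurable t).sub (hX.measurable s)) fun I => ?_
  obtain ⟨τ, N, hτ, h0, hN, hN1, hI⟩ := exists_monotone_seq_through
    (I.image (fun r : Set.Iic s => (r : ℝ≥0))) hst (by
    intro r hr
    obtain ⟨q, -, rfl⟩ := Finset.mem_image.1 hr
    exact q.2)
  have hI' : ∀ r : I, ∃ i ≤ N, τ i = (r : Set.Iic s) := fun r =>
    hI _ (Finset.mem_image_of_mem _ r.2)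
  choose idx hidx hidxτ using hI'
  have hind := (hX.indep.nat hτ).indepFun_finset (Finset.range N) {N} (by simp)
    (fun i => (hX.measurable _).sub (hX.measurable _))
  -- `φ` rebuilds the past values from the increments by telescoping. Since X_0 = 0 holds only
  -- almost surely, so does the resulting equality.
  let φ : (Finset.range N → ℝ) → I → ℝ := fun y r =>
    ∑ k ∈ Finset.range (idx r), if h : k ∈ Finset.range N then y ⟨k, h⟩ else 0
  have hφ : Measurable φ := by
    refine measurable_pi_lambda _ fun r => Finset.measurable_fun_sum _ fun k _ => ?_
    split_ifs
    · exact measurable_pi_apply _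
    · exact measurable_const
  have hψ : Measurable (fun y : (({N} : Finset ℕ) → ℝ) => y ⟨N, by simp⟩) := measurable_pi_apply _
  refine (hind.comp hφ hψ).congr ?_ (.of_forall fun ω => ?_)
  · filter_upwards [hX.start] with ω hω
    funext r
    have h1 : ∀ k ∈ Finset.range (idx r), (if h : k ∈ Finset.range N then
        X (τ (k + 1)) ω - X (τ k) ω else 0) = X (τ (k + 1)) ω - X (τ k) ω := by
      intro k hk
      rw [dif_pos (Finset.mem_range.2 ((Finset.mem_range.1 hk).trans_le (hidx r)))]
    simp only [φ, Function.comp]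
    rw [Finset.sum_congr rfl h1, Finset.sum_range_sub (fun k => X (τ k) ω), h0, hω, sub_zero,
      hidxτ]
  · simp [hN, hN1]

/-- The natural filtration of the process `X` at time `s`. -/
abbrev pastSigmaAlgebra {Ω : Type*} (X : ℝ≥0 → Ω → ℝ) (s : ℝ≥0) : MeasurableSpace Ω :=
  ⨆ r : Set.Iic s, MeasurableSpace.comap (X r) inferInstance

theorem pastSigmaAlgebra_eq_comap {Ω : Type*} (X : ℝ≥0 → Ω → ℝ) (s : ℝ≥0) :
    pastSigmaAlgebra X s =
      MeasurableSpace.comap (fun ω (r : Set.Iic s) => X r ω) MeasurableSpace.pi := by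
  simp only [pastSigmaAlgebra, MeasurableSpace.pi, MeasurableSpace.comap_iSup, MeasurableSpace.comap_comp]
  rfl

theorem IsLevyProcess.pastSigmaAlgebra_le (hX : IsLevyProcess X P) (s : ℝ≥0) :
    pastSigmaAlgebra X s ≤ ‹MeasurableSpace Ω› :=
  iSup_le fun r => (hX.measurable r).comap_le

/-- Expand X_t^i = (X_s + D)^i: powers of X_s are measurable for the past and come out, and powers
of D are independent of it and have the moments of X_{t-s}. This is the probabilistic counterpart of
`condE`. -/
theorem IsLevyProcess.condExp_pow [IsProbabilityMeasure P] (hX : IsLevyProcess X P)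
    (hint : ∀ (t : ℝ≥0) (n : ℕ), Integrable (fun ω => X t ω ^ n) P) {s t : ℝ≥0} (hst : s ≤ t)
    (i : ℕ) :
    P[fun ω => X t ω ^ i | pastSigmaAlgebra X s] =ᵐ[P]
      fun ω => ∑ j ∈ Finset.range (i + 1),
        ((i.choose j : ℝ) * ∫ ω', X (t - s) ω' ^ (i - j) ∂P) * X s ω ^ j := by
  have hle := hX.pastSigmaAlgebra_le s
  set D : Ω → ℝ := fun ω => X t ω - X s ω with hD
  have hDm : Measurable D := (hX.measurable t).sub (hX.measurable s)
  have hid : IdentDistrib D (X (t - s)) P P := by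
    have := hX.stationary s (t - s)
    rwa [add_tsub_cancel_of_le hst] at this
  have hidp (n : ℕ) : IdentDistrib (fun ω => D ω ^ n) (fun ω => X (t - s) ω ^ n) P P :=
    hid.comp (measurable_id.pow_const n)
  have hDint (n : ℕ) : Integrable (fun ω => D ω ^ n) P := (hidp n).integrable_iff.2 (hint _ n)
  have hpast := hX.indepFun_past_increment hst
  have hindep : Indep (MeasurableSpace.comap D inferInstance) (pastSigmaAlgebra X s) P := by
    rw [pastSigmaAlgebra_eq_comap]
    exact hpast.symm
  have hXD : IndepFun (X s) D P :=
    hpast.comp (measurable_pi_apply (⟨s, Set.mem_Iic.2 le_rfl⟩ : Set.Iic s)) measurable_id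
  have hXs : Measurable[pastSigmaAlgebra X s] (X s) :=
    (comap_measurable (X s)).mono (le_iSup (fun r : Set.Iic s =>
      MeasurableSpace.comap (X r) inferInstance) ⟨s, Set.mem_Iic.2 le_rfl⟩) le_rfl
  have hprod (j n : ℕ) : Integrable (fun ω => X s ω ^ j * D ω ^ n) P :=
    (hXD.comp (measurable_id.pow_const j) (measurable_id.pow_const n)).integrable_mul
      (hint s j) (hDint n)
  have hterm (j n : ℕ) : P[fun ω => X s ω ^ j * D ω ^ n | pastSigmaAlgebra X s] =ᵐ[P]
      fun ω => (∫ ω', X (t - s) ω' ^ n ∂P) * X s ω ^ j := by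
    have h1 : P[fun ω => X s ω ^ j * D ω ^ n | pastSigmaAlgebra X s] =ᵐ[P]
        (fun ω => X s ω ^ j) * P[fun ω => D ω ^ n | pastSigmaAlgebra X s] :=
      condExp_mul_of_stronglyMeasurable_left (hXs.pow_const j).stronglyMeasurable
        (hprod j n) (hDint n)
    have h2 : P[fun ω => D ω ^ n | pastSigmaAlgebra X s] =ᵐ[P] fun _ => ∫ ω, D ω ^ n ∂P :=
      condExp_indep_eq hDm.comap_le hle
        ((comap_measurable D).pow_const n).stronglyMeasurable hindep
    filter_upwards [h1, h2] with ω hω1 hω2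
    rw [hω1, Pi.mul_apply, hω2, (hidp n).integral_eq, mul_comm]
  have hexp : (fun ω => X t ω ^ i) = ∑ j ∈ Finset.range (i + 1),
      (i.choose j : ℝ) • (fun ω => X s ω ^ j * D ω ^ (i - j)) := by
    funext ω
    have : X t ω = X s ω + D ω := by simp [hD]
    rw [this, add_pow, Finset.sum_apply]
    refine Finset.sum_congr rfl fun j _ => ?_
    simp only [Pi.smul_apply, smul_eq_mul]
    ring
  rw [hexp]
  have h3 := condExp_finsetSum (m := pastSigmaAlgebra X s) (μ := P) (s := Finset.range (i + 1))
    (f := fun j => (i.choose j : ℝ) • (fun ω => X s ω ^ j * D ω ^ (i - j)))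
    (fun j _ => (hprod j (i - j)).smul _)
  have h4 : ∀ᵐ ω ∂P, ∀ j ∈ Finset.range (i + 1),
      (P[(i.choose j : ℝ) • (fun ω => X s ω ^ j * D ω ^ (i - j)) | pastSigmaAlgebra X s]) ω =
        ((i.choose j : ℝ) * ∫ ω', X (t - s) ω' ^ (i - j) ∂P) * X s ω ^ j := by
    refine (ae_ball_iff (Finset.countable_toSet _)).2 fun j _ => ?_
    filter_upwards [condExp_smul (μ := P) (i.choose j : ℝ)
      (fun ω => X s ω ^ j * D ω ^ (i - j)) (pastSigmaAlgebra X s), hterm j (i - j)] with ω hω1 hω2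
    rw [hω1, Pi.smul_apply, hω2, smul_eq_mul, mul_assoc]
  filter_upwards [h3, h4] with ω hω3 hω4
  rw [hω3, Finset.sum_apply]
  exact Finset.sum_congr rfl hω4

theorem integrable_eval_of_integrable_pow (hint : ∀ (t : ℝ≥0) (n : ℕ), Integrable (fun ω => X t ω ^ n) P)
    (Q : ℝ[X]) (t : ℝ≥0) : Integrable (fun ω => Q.eval (X t ω)) P := by
  simp_rw [Polynomial.eval_eq_sum_range]
  exact integrable_finsetSum _ fun i _ => (hint t i).const_mul _

theorem IsLevyProcess.condExp_sum_pow [IsProbabilityMeasure P] (hX : IsLevyProcess X P)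
    (hint : ∀ (t : ℝ≥0) (n : ℕ), Integrable (fun ω => X t ω ^ n) P) {s t : ℝ≥0} (hst : s ≤ t)
    (c : ℕ → ℝ) (k : ℕ) :
    P[fun ω => ∑ i ∈ Finset.range k, c i * X t ω ^ i |
        pastSigmaAlgebra X s] =ᵐ[P]
      fun ω => ∑ i ∈ Finset.range k, c i * ∑ j ∈ Finset.range (i + 1),
        ((i.choose j : ℝ) * ∫ ω', X (t - s) ω' ^ (i - j) ∂P) * X s ω ^ j := by
  have hsum : (fun ω => ∑ i ∈ Finset.range k, c i * X t ω ^ i) =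
      ∑ i ∈ Finset.range k, c i • fun ω => X t ω ^ i := by
    funext ω
    simp [Finset.sum_apply]
  rw [hsum]
  have h3 := condExp_finsetSum (m := pastSigmaAlgebra X s) (μ := P) (s := Finset.range k)
    (f := fun i => c i • fun ω => X t ω ^ i) (fun i _ => (hint t i).smul _)
  have h4 : ∀ᵐ ω ∂P, ∀ i ∈ Finset.range k, (P[c i • (fun ω => X t ω ^ i) | pastSigmaAlgebra X s]) ω =
      c i * ∑ j ∈ Finset.range (i + 1),
        ((i.choose j : ℝ) * ∫ ω', X (t - s) ω' ^ (i - j) ∂P) * X s ω ^ j := by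
    refine (ae_ball_iff (Finset.countable_toSet _)).2 fun i _ => ?_
    filter_upwards [condExp_smul (μ := P) (c i) (fun ω => X t ω ^ i) (pastSigmaAlgebra X s),
      hX.condExp_pow hint hst i] with ω hω1 hω2
    rw [hω1, Pi.smul_apply, hω2, smul_eq_mul]
  filter_upwards [h3, h4] with ω hω3 hω4
  rw [hω3, Finset.sum_apply]
  exact Finset.sum_congr rfl hω4

end LevyProcess

/-! ### Compositional inverses, and the generating function of α·β·γ^{<-1>}. -/

namespace Umbra

open PowerSeries

section CompositionalInverse

variable {γ : Umbra} {U : ℝ⟦X⟧}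

theorem exists_isCompInverse (hγ : γ.genFun = 1 + PowerSeries.map Polynomial.C U)
    (hU : constantCoeff U = 0) (hU1 : IsUnit (coeff 1 U)) : ∃ η : Umbra, IsCompInverse γ η := by
  set h := U.substInvOfIsUnit hU1
  have hh : constantCoeff h = 0 := constantCoeff_substInvOfIsUnit _ hU1
  have hc : constantCoeff (1 + PowerSeries.map Polynomial.C h) = 1 := by
    rw [map_add, ← coeff_zero_eq_constantCoeff_apply, ← coeff_zero_eq_constantCoeff_apply, coeff_map,
      coeff_zero_eq_constantCoeff_apply, coeff_zero_eq_constantCoeff_apply, hh]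
    simp
  have hcomp {F D : ℝ⟦X⟧} (hD : constantCoeff D = 0) (hFD : F.subst D = (X : ℝ⟦X⟧)) :
      (1 + PowerSeries.map Polynomial.C F).subst (PowerSeries.map Polynomial.C D) =
        (1 + X : ℝ[X]⟦X⟧) := by
    have hD' : HasSubst (PowerSeries.map (Polynomial.C : ℝ →+* ℝ[X]) D) :=
      HasSubst.of_constantCoeff_zero' (by
        rw [← coeff_zero_eq_constantCoeff_apply, coeff_map, coeff_zero_eq_constantCoeff_apply, hD,
          map_zero])
    rw [subst_add hD', subst_one hD', ← map_C_subst F hD, hFD, map_X]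
  refine ⟨ofGenFun _ hc, ?_, similar_iff_genFun_eq.2 ?_, similar_iff_genFun_eq.2 ?_⟩
  · have h1 := umbralE_toPoly_pow γ 1
    rw [pow_one] at h1
    rw [h1, moment_eq, hγ, map_add, coeff_map]
    simpa [coeff_one] using hU1.ne_zero
  · rw [genFun_comp, genFun_ofGenFun, genFun_singleton, hγ, add_sub_cancel_left]
    exact hcomp hh (subst_substInvOfIsUnit_right U hU hU1)
  · rw [genFun_comp, genFun_ofGenFun, genFun_singleton, hγ, add_sub_cancel_left]
    exact hcomp hU (subst_substInvOfIsUnit_left U hU hU1)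

/-- An inverse umbra may a priori have moments depending on x. Composing U∘(f(η) - 1) = z on the
left with the real inverse series of `U` forces its moments to be constants. -/
theorem IsCompInverse.genFun_sub_one_eq {η : Umbra} (hη : IsCompInverse γ η)
    (hγ : γ.genFun = 1 + PowerSeries.map Polynomial.C U)
    (hU : constantCoeff U = 0) (hU1 : IsUnit (coeff 1 U)) :
    η.genFun - 1 = PowerSeries.map Polynomial.C (U.substInvOfIsUnit hU1) := by
  have hs := η.hasSubst_genFun_sub_one
  have h1 := similar_iff_genFun_eq.1 hη.2.1
  rw [genFun_comp, genFun_singleton, hγ, subst_add hs, subst_one hs, add_right_inj] at h1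
  have h2 : (PowerSeries.map (Polynomial.C : ℝ →+* ℝ[X]) (U.substInvOfIsUnit hU1)).subst
      (PowerSeries.map (Polynomial.C : ℝ →+* ℝ[X]) U) = (X : ℝ[X]⟦X⟧) := by
    rw [← map_C_subst _ hU, subst_substInvOfIsUnit_left U hU hU1, map_X]
  have hU' : HasSubst (PowerSeries.map (Polynomial.C : ℝ →+* ℝ[X]) U) :=
    HasSubst.of_constantCoeff_zero' (by
      rw [← coeff_zero_eq_constantCoeff_apply, coeff_map, coeff_zero_eq_constantCoeff_apply, hU,
        map_zero])
  calc η.genFun - 1 = (X : ℝ[X]⟦X⟧).subst (η.genFun - 1) := (subst_X hs).symm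
    _ = _ := by rw [← h2, subst_comp_subst_apply hU' hs, h1, X_subst]

theorem IsCompInverse.exists_genFun_comp {η : Umbra} (hη : IsCompInverse γ η)
    (hγ : γ.genFun = 1 + PowerSeries.map Polynomial.C U)
    (hU : constantCoeff U = 0) (hU1 : IsUnit (coeff 1 U)) {α : Umbra} {A : ℝ⟦X⟧}
    (hA : constantCoeff A = 1) (hα : α.genFun = PowerSeries.map Polynomial.C A) :
    ∃ G : ℝ⟦X⟧, constantCoeff G = 1 ∧ G.subst U = A ∧
      (comp α η).genFun = PowerSeries.map Polynomial.C G := by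
  have hh : constantCoeff (U.substInvOfIsUnit hU1) = 0 := constantCoeff_substInvOfIsUnit _ hU1
  refine ⟨A.subst (U.substInvOfIsUnit hU1), ?_, ?_, ?_⟩
  · rw [constantCoeff_subst_of_zero hh, hA]
  · rw [subst_comp_subst_apply (HasSubst.of_constantCoeff_zero' hh)
      (HasSubst.of_constantCoeff_zero' hU), subst_substInvOfIsUnit_left U hU hU1, X_subst]
  · rw [genFun_comp, hα, hη.genFun_sub_one_eq hγ hU hU1, map_C_subst _ hh]

end CompositionalInverse

/-! ### The Bell polynomial expansion and both forms of harmonicity. -/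

section Sheffer

variable {δ γ : Umbra} {A G U : ℝ⟦X⟧}

theorem umbralE_add_pow (q : ℝ[X]) (ζ : Umbra) (i : ℕ) :
    umbralE ((MvPolynomial.C q + ζ.toPoly) ^ i) =
      ∑ j ∈ Finset.range (i + 1), (i.choose j : ℝ[X]) * ζ.moment (i - j) * q ^ j := by
  rw [add_pow, map_sum]
  refine Finset.sum_congr rfl fun j _ => ?_
  have : (MvPolynomial.C q ^ j * ζ.toPoly ^ (i - j) * (i.choose j : UmbralPoly)) =
      MvPolynomial.C (q ^ j * (i.choose j : ℝ[X])) * ζ.toPoly ^ (i - j) := by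
    rw [map_mul, map_pow, map_natCast]
    ring
  rw [this, umbralE_C_mul, umbralE_toPoly_pow]
  ring

/-- Since A^0 = 1, Bell polynomials are the Sheffer coefficients at time 0; this makes the core
identity applicable with a = 0. -/
theorem partialBell_eq_shefferCoeff (hA : constantCoeff A = 1)
    (hγ : γ.genFun = 1 + PowerSeries.map Polynomial.C U) (k i : ℕ) :
    partialBell k i (fun j => umbralE (γ.toPoly ^ j)) =
      Polynomial.C (shefferCoeff A U 0 k i) := by
  simp_rw [umbralE_toPoly_pow]
  rw [partialBell_eq, hγ, add_sub_cancel_left, ← map_pow (PowerSeries.map _), coeff_map, ← map_mul,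
    shefferCoeff, binPow_zero hA, one_mul]

theorem sum_umbralE_mul_partialBell (hA : constantCoeff A = 1) (hU : constantCoeff U = 0)
    (hG : constantCoeff G = 1) (hGU : G.subst U = A)
    (hδ : δ.genFun = PowerSeries.map Polynomial.C G)
    (hγ : γ.genFun = 1 + PowerSeries.map Polynomial.C U) (t : ℝ) (k : ℕ) :
    ∑ i ∈ Finset.range (k + 1),
      umbralE ((MvPolynomial.C Polynomial.X + (realDot t δ).toPoly) ^ i) *
        partialBell k i (fun j => umbralE (γ.toPoly ^ j)) =
    ∑ j ∈ Finset.range (k + 1), shefferCoeff A U t k j • (Polynomial.X : ℝ[X]) ^ j := by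
  have h := sum_shefferCoeff_smul_binomial hA hU hG hGU 0 t k (Polynomial.X : ℝ[X])
  rw [zero_add] at h
  rw [← h]
  refine Finset.sum_congr rfl fun i _ => ?_
  rw [partialBell_eq_shefferCoeff hA hγ, mul_comm, ← Polynomial.smul_eq_C_mul, umbralE_add_pow]
  congr 1
  refine Finset.sum_congr rfl fun j _ => ?_
  rw [moment_realDot hG hδ, Polynomial.smul_eq_C_mul, map_mul Polynomial.C (i.choose j : ℝ)]
  simp

theorem condE_X_pow (s t : ℝ) (i : ℕ) : condE δ s t (Polynomial.X ^ i) =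
    ∑ j ∈ Finset.range (i + 1), (i.choose j : UmbralPoly) * (realDot s δ).toPoly ^ j *
      MvPolynomial.C ((realDot (t - s) δ).moment (i - j)) := by
  have h : (Polynomial.X ^ i : ℝ[X]) = Polynomial.basisMonomials ℝ i := by
    rw [Polynomial.coe_basisMonomials, Polynomial.X_pow_eq_monomial]
  rw [h, condE, Module.Basis.constr_basis]
  simp_rw [umbralE_toPoly_pow]

theorem isTimeSpaceHarmonic_of_eq_sum_shefferCoeff (hA : constantCoeff A = 1)
    (hU : constantCoeff U = 0) (hG : constantCoeff G = 1) (hGU : G.subst U = A)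
    (hδ : δ.genFun = PowerSeries.map Polynomial.C G) {Q : ℝ → ℝ[X]} {k : ℕ}
    (hQ : ∀ t, 0 ≤ t → Q t =
      ∑ i ∈ Finset.range (k + 1), shefferCoeff A U t k i • (Polynomial.X : ℝ[X]) ^ i) :
    IsTimeSpaceHarmonic Q (fun t => -t) δ := by
  intro s t hs hst
  -- With θ(t) = -t, the increment θ(t) - θ(s) = s - t is the exponent b, bringing the Sheffer
  -- coefficients from time t back to time s.
  have h := sum_shefferCoeff_smul_binomial hA hU hG hGU t (-t - -s) k (realDot (-s) δ).toPoly
  rw [show t + (-t - -s) = s by ring] at h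
  rw [hQ t (hs.trans hst), hQ s hs, map_sum, map_sum]
  simp_rw [map_smul, map_pow, Polynomial.aeval_X]
  rw [← h]
  refine Finset.sum_congr rfl fun i _ => ?_
  rw [condE_X_pow]
  congr 1
  refine Finset.sum_congr rfl fun j _ => ?_
  have hC (r : ℝ) (p : UmbralPoly) : r • p = MvPolynomial.C (Polynomial.C r) * p :=
    Algebra.smul_def r p
  rw [moment_realDot hG hδ, hC, map_mul Polynomial.C (i.choose j : ℝ),
    map_mul MvPolynomial.C (Polynomial.C (i.choose j : ℝ)), map_natCast, map_natCast]
  ring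

theorem isTimeSpaceHarmonicProcess_of_eq_sum_shefferCoeff (hA : constantCoeff A = 1)
    (hU : constantCoeff U = 0) (hG : constantCoeff G = 1) (hGU : G.subst U = A)
    (hδ : δ.genFun = PowerSeries.map Polynomial.C G) {Q : ℝ → ℝ[X]} {k : ℕ}
    (hQ : ∀ t, 0 ≤ t → Q t =
      ∑ i ∈ Finset.range (k + 1), shefferCoeff A U t k i • (Polynomial.X : ℝ[X]) ^ i)
    {Ω : Type*} [MeasurableSpace Ω] {P : Measure Ω} [IsProbabilityMeasure P] {X : ℝ≥0 → Ω → ℝ}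
    (hX : IsLevyProcess X P)
    (hrep : IsUmbrallyRepresented X P (fun t => realDot (-(t : ℝ)) δ)) :
    IsTimeSpaceHarmonicProcess Q X P := by
  have hint (t : ℝ≥0) (n : ℕ) : Integrable (fun ω => X t ω ^ n) P := (hrep t n).1
  have hmom (t : ℝ≥0) (n : ℕ) :
      ∫ ω, X t ω ^ n ∂P = n.factorial * coeff n (binPow G (-(t : ℝ))) := by
    have h := (hrep t n).2
    rw [umbralE_toPoly_pow, moment_realDot hG hδ] at h
    exact Polynomial.C_injective h
  have heval (t : ℝ≥0) (y : ℝ) : (Q t).eval y =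
      ∑ i ∈ Finset.range (k + 1), shefferCoeff A U t k i * y ^ i := by
    rw [hQ t t.coe_nonneg, Polynomial.eval_finsetSum]
    simp
  refine ⟨fun t => integrable_eval_of_integrable_pow hint _ t, fun s t hst => ?_⟩
  simp_rw [heval]
  filter_upwards [hX.condExp_sum_pow hint hst (fun i => shefferCoeff A U t k i) (k + 1)] with ω hω
  refine hω.trans ?_
  -- X_{t-s} has the moments given by G^{-(t-s)}, so b = -(t-s) and the total exponent is s.
  have h := sum_shefferCoeff_smul_binomial hA hU hG hGU (t : ℝ) (-((t - s : ℝ≥0) : ℝ)) k (X s ω)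
  rw [show (t : ℝ) + -((t - s : ℝ≥0) : ℝ) = s by rw [NNReal.coe_sub hst]; ring] at h
  simpa [hmom] using h

end Sheffer

end Umbra

end

theorem mainTheorem4 (V : ℕ → ℝ → Polynomial ℝ) (g u : ℝ → ℝ)
    (hV : IsLevyShefferSystem V g u) (α γ : Umbra)
    (hα : α.genFun = taylorAtZero g) (hγ : γ.genFun = 1 + taylorAtZero u) :
    (∃ η : Umbra, Umbra.IsCompInverse γ η) ∧
    ∀ η : Umbra, Umbra.IsCompInverse γ η →
      (∃ κ : Umbra, Umbra.IsCumulant κ (Umbra.comp α η)) ∧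
      (∀ κ : Umbra, Umbra.IsCumulant κ (Umbra.comp α η) →
        ∀ (k : ℕ) (t : ℝ), 0 ≤ t →
          V k t = ∑ i ∈ Finset.range (k + 1),
            umbralE ((MvPolynomial.C Polynomial.X +
              (Umbra.realDot t (Umbra.dot Umbra.bell κ)).toPoly) ^ i) *
              partialBell k i (fun j => umbralE (γ.toPoly ^ j))) ∧
      (∀ k : ℕ, Umbra.IsTimeSpaceHarmonic (V k) (fun t => -t) (Umbra.comp α η)) ∧
      (∀ (Ω : Type*) [MeasurableSpace Ω] (P : Measure Ω) [IsProbabilityMeasure P]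
        (X : ℝ≥0 → Ω → ℝ), IsLevyProcess X P →
        IsUmbrallyRepresented X P (fun t => Umbra.realDot (-(t : ℝ)) (Umbra.comp α η)) →
        ∀ k : ℕ, IsTimeSpaceHarmonicProcess (V k) X P) := by
  rw [taylorAtZero_eq_map] at hα hγ
  have hA : PowerSeries.constantCoeff (realTaylor g) = 1 := by
    rw [constantCoeff_realTaylor, hV.g_zero]
  have hU : PowerSeries.constantCoeff (realTaylor u) = 0 := by
    rw [constantCoeff_realTaylor, hV.u_zero]
  have hU1 : IsUnit (PowerSeries.coeff 1 (realTaylor u)) := by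
    rw [coeff_one_realTaylor]
    exact hV.deriv_u_ne_zero.isUnit
  refine ⟨Umbra.exists_isCompInverse hγ hU hU1, fun η hη => ?_⟩
  obtain ⟨G, hG, hGU, hδ⟩ := hη.exists_genFun_comp hγ hU hU1 hA hα
  refine ⟨Umbra.exists_isCumulant _, fun κ hκ k t ht => ?_, fun k => ?_, ?_⟩
  · rw [hV.eq_sum_shefferCoeff ht]
    -- The cumulant κ enters only through β·κ, whose generating function is the same `G`.
    exact (Umbra.sum_umbralE_mul_partialBell hA hU hG hGU
      ((Umbra.similar_iff_genFun_eq.1 hκ).symm.trans hδ) hγ t k).symm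
  · exact Umbra.isTimeSpaceHarmonic_of_eq_sum_shefferCoeff hA hU hG hGU hδ
      fun t ht => hV.eq_sum_shefferCoeff ht k
  · intro Ω _ P _ X hX hrep k
    exact Umbra.isTimeSpaceHarmonicProcess_of_eq_sum_shefferCoeff hA hU hG hGU hδ
      (fun t ht => hV.eq_sum_shefferCoeff ht k) hX hrep
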